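/- Let $k$ be an algebraically closed field of characteristic $\chi>0$, let $m,n\ge 1$ be integers, and let $\mathbf f=(f_1,\dots,f_m)$ be a sequence of polynomials in $k[t_1,\dots,t_n]$ that is algebraically independent over $k$. Let $k[\mathbf f]$ be the $k$-subalgebra of $k[t_1,\dots,t_n]$ generated by $f_1,\dots,f_m$. Let $k\langle \mathbf f\rangle$ be the $k$-subalgebra of all $g\in k[t_1,\dots,t_n]$ that are determined by $\mathbf f$, i.e. such that for all $\mathbf a,\mathbf b\in k^n$ with $f_i(\mathbf a)=f_i(\mathbf b)$ for $i=1,\dots,m$ we have $g(\mathbf a)=g(\mathbf b)$. For $P\subseteq k[t_1,\dots,t_n]$ put $$\operatorname{rad}_\chi(P)=\{g\in k[t_1,\dots,t_n] : g^{\chi^\nu}\in P \text{ for some integer } \nu\ge 0\}.$$ The dimension of a nonempty algebraic set $A\subseteq k^m$ is the maximal $d\in\{0,\dots,m\}$ for which there are $i_1<\dots<i_d$ in $\{1,\dots,m\}$ such that no nonzero polynomial in $k[x_{i_1},\dots,x_{i_d}]$ vanishes on $A$, and $\dim\emptyset=-1$. Call $\mathbf f$ almost surjective if the Zariski closure of $k^m\setminus\{(f_1(\mathbf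 a),\dots,f_m(\mathbf a)) : \mathbf a\in k^n\}$ has dimension at most $m-2$. Then the following are equivalent: 1. $k\langle \mathbf f\rangle=\operatorname{rad}_\chi(k[\mathbf f])$; 2. $\mathbf f$ is almost surjective. -/

import Mathlib

namespace FDetermined

open MvPolynomial

variable {k : Type*} [Field k] {m n : ℕ}

/-- The map `k^n → k^m` induced by a tuple `f` of polynomials. -/
noncomputable def polyMap (f : Fin m → MvPolynomial (Fin n) k) (a : Fin n → k) : Fin m → k :=
  fun i => eval a (f i)

/-- `k⟨f⟩`: the subalgebra of the polynomials `g` such that `g a` depends only on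
`f a = (f₁ a, …, f_m a)`. -/
noncomputable def determined (f : Fin m → MvPolynomial (Fin n) k) :
    Subalgebra k (MvPolynomial (Fin n) k) where
  carrier := {g | ∀ a b : Fin n → k, (∀ i, eval a (f i) = eval b (f i)) → eval a g = eval b g}
  mul_mem' := by
    intro g h hg hh a b hab
    rw [map_mul, map_mul, hg a b hab, hh a b hab]
  add_mem' := by
    intro g h hg hh a b hab
    rw [map_add, map_add, hg a b hab, hh a b hab]
  algebraMap_mem' := by
    intro r a b _
    simp [MvPolynomial.algebraMap_eq]

/-- `rad_χ(P)`: the polynomials having some `χ ^ ν`-th power (`ν ≥ 0`) in `P`. -/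
def radChar (χ : ℕ) (P : Set (MvPolynomial (Fin n) k)) : Set (MvPolynomial (Fin n) k) :=
  {g | ∃ ν : ℕ, g ^ χ ^ ν ∈ P}

/-- The Zariski closure `V(I(A))` of a set `A ⊆ k^m`. -/
def zariskiClosure (A : Set (Fin m → k)) : Set (Fin m → k) :=
  zeroLocus k (vanishingIdeal k A)

open scoped Classical in
/-- The dimension of an algebraic set `A ⊆ k^m`: the largest `d` for which there are `d` of the
variables (a subset `S` of the indices with `d` elements) such that no nonzero polynomial in these
variables alone vanishes on `A`. By convention the empty set has dimension `-1`. -/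
noncomputable def algDim (A : Set (Fin m → k)) : ℤ :=
  if A = ∅ then -1
  else (((Finset.univ : Finset (Finset (Fin m))).filter fun S : Finset (Fin m) =>
    ∀ p ∈ vanishingIdeal k A, p ∈ supported k (S : Set (Fin m)) → p = 0).sup Finset.card : ℕ)

/-- `f` is almost surjective: the Zariski closure of the complement of its range has dimension at
most `m - 2` (an integer subtraction). -/
def AlmostSurjective (f : Fin m → MvPolynomial (Fin n) k) : Prop :=
  algDim (zariskiClosure (Set.range (polyMap f))ᶜ) ≤ (m : ℤ) - 2

end FDetermined

namespace FDetermined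

open MvPolynomial

/-! Polynomials in `radChar` are determined because Frobenius is injective on `k`. If `g` is
determined, the Nullstellensatz on two copies of affine space, read in `L ⊗[K] L` with `K = k(f)`,
gives `v(f) g^(χ^ν) = u(f)` with `u`, `v` coprime. For a prime `q ∣ v` involving `X j`, almost
surjectivity supplies `p ≠ 0` free of `X j` and zero off the image. Then `u * p` vanishes where `q`
does, so `q ∣ u`, which is absurd; hence `v` is a unit. Conversely, if almost surjectivity fails,
Chevalley's theorem gives a prime `h` with `(h)` outside the image on spectra, hence `h(f) ∣ u(f)`
with `h ∤ u`. Then `u(f)² / h(f)` is determined but has no `χ^ν`-th power in `k[f]`. -/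

/-- Descent along a field extension. -/
theorem mem_range_algebraMap_of_tmul_one_eq {K L : Type*} [Field K] [Field L] [Algebra K L] {a : L}
    (h : a ⊗ₜ[K] (1 : L) = (1 : L) ⊗ₜ[K] a) : a ∈ Set.range (algebraMap K L) := by
  obtain ⟨φ, hφ⟩ := LinearMap.exists_leftInverse_of_injective (Algebra.linearMap K L)
    (LinearMap.ker_eq_bot.mpr (algebraMap K L).injective)
  have h1 : φ 1 = 1 := by simpa using LinearMap.congr_fun hφ 1
  -- The map `x ⊗ y ↦ φ y • x` sends the two sides to `a` and to `φ a • 1`.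
  have := congrArg (TensorProduct.lift ((LinearMap.lsmul K L).flip.compl₂ φ)) h
  refine ⟨φ a, ?_⟩
  rw [Algebra.algebraMap_eq_smul_one]
  simpa [h1] using this.symm

section Nullstellensatz

variable {k : Type*} [Field k] [IsAlgClosed k]

theorem mem_radical_of_forall_eval {σ : Type*} [Finite σ] {I : Ideal (MvPolynomial σ k)}
    {p : MvPolynomial σ k} (h : ∀ x : σ → k, (∀ q ∈ I, eval x q = 0) → eval x p = 0) :
    p ∈ I.radical := by
  rw [← vanishingIdeal_zeroLocus_eq_radical (K := k) I]
  intro x hx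
  rw [aeval_eq_eval]
  exact h x fun q hq => by simpa [aeval_eq_eval] using hx q hq

theorem exists_eval_eq_zero_of_ne_top {σ : Type*} [Finite σ] {I : Ideal (MvPolynomial σ k)}
    (h : I ≠ ⊤) : ∃ x : σ → k, ∀ q ∈ I, eval x q = 0 := by
  by_contra! hx
  refine h (Ideal.radical_eq_top.mp ((Ideal.eq_top_iff_one _).mpr
    (mem_radical_of_forall_eval fun x h' => ?_)))
  obtain ⟨q, hq, hne⟩ := hx x
  exact absurd (h' q hq) hne

theorem dvd_of_forall_eval {σ : Type*} [Finite σ] {h p : MvPolynomial σ k} (hh : Prime h)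
    (H : ∀ x : σ → k, eval x h = 0 → eval x p = 0) : h ∣ p := by
  have : (Ideal.span {h}).IsPrime := (Ideal.span_singleton_prime hh.ne_zero).mpr hh
  rw [← Ideal.mem_span_singleton, ← this.radical]
  exact mem_radical_of_forall_eval fun x hx => H x (hx h (Ideal.mem_span_singleton_self h))

end Nullstellensatz

variable {k : Type*} [Field k] {m n : ℕ}

theorem eval_aeval (f : Fin m → MvPolynomial (Fin n) k) (a : Fin n → k)
    (p : MvPolynomial (Fin m) k) : eval a (aeval f p) = eval (polyMap f a) p := by
  have : (aeval a : MvPolynomial (Fin n) k →ₐ[k] k).comp (aeval f) = aeval (polyMap f a) := by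
    ext i; simp [polyMap, aeval_eq_eval]
  simpa [aeval_eq_eval] using DFunLike.congr_fun this p

theorem radChar_subset_determined {χ : ℕ} [CharP k χ] (hχ : 0 < χ)
    (f : Fin m → MvPolynomial (Fin n) k) :
    radChar χ (Algebra.adjoin k (Set.range f) : Set (MvPolynomial (Fin n) k)) ⊆ determined f := by
  rintro g ⟨ν, hg⟩ a b hab
  have : NeZero χ := ⟨hχ.ne'⟩
  have : Fact χ.Prime := ⟨CharP.char_is_prime_of_pos k χ |>.out⟩
  rw [SetLike.mem_coe, Algebra.adjoin_range_eq_range_aeval] at hg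
  obtain ⟨p, hp⟩ := hg
  apply iterateFrobenius_inj k χ ν
  have hab' : polyMap f a = polyMap f b := funext hab
  rw [iterateFrobenius_def, iterateFrobenius_def, ← map_pow, ← map_pow, ← hp]
  exact (eval_aeval f a p).trans (hab' ▸ (eval_aeval f b p).symm)

/-- A polynomial determined by `f` is purely inseparable over the field `k(f)`. -/
theorem exists_pow_mul_aeval_eq_aeval [IsAlgClosed k] {χ : ℕ} [CharP k χ] (hχ : 0 < χ)
    {f : Fin m → MvPolynomial (Fin n) k} (hf : AlgebraicIndependent k f)
    {g : MvPolynomial (Fin n) k} (hg : g ∈ determined f) :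
    ∃ (ν : ℕ) (u v : MvPolynomial (Fin m) k), v ≠ 0 ∧ aeval f v * g ^ χ ^ ν = aeval f u := by
  have : NeZero χ := ⟨hχ.ne'⟩
  have hprime : Fact χ.Prime := ⟨CharP.char_is_prime_of_pos k χ |>.out⟩
  let D (p : MvPolynomial (Fin n) k) : MvPolynomial (Fin n ⊕ Fin n) k :=
    rename Sum.inl p - rename Sum.inr p
  have hD : D g ∈ (Ideal.span (Set.range fun i => D (f i))).radical := by
    refine mem_radical_of_forall_eval fun x hx => ?_
    simp only [D, map_sub, eval_rename, sub_eq_zero]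
    refine hg _ _ fun i => ?_
    simpa [D, eval_rename, sub_eq_zero] using hx _ (Ideal.subset_span ⟨i, rfl⟩)
  obtain ⟨ν, hν⟩ := hD
  let L := FractionRing (MvPolynomial (Fin n) k)
  let ι : MvPolynomial (Fin n) k →ₐ[k] L := Algebra.ofId _ L |>.restrictScalars k
  have hι : Function.Injective ι := IsFractionRing.injective (MvPolynomial (Fin n) k) L
  let K := IntermediateField.adjoin k (Set.range fun i => ι (f i))
  let l : L →ₐ[k] TensorProduct K L L := Algebra.TensorProduct.includeLeft
  let r : L →ₐ[k] TensorProduct K L L :=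
    (Algebra.TensorProduct.includeRight : L →ₐ[K] TensorProduct K L L).restrictScalars k
  let Ψ : MvPolynomial (Fin n ⊕ Fin n) k →ₐ[k] TensorProduct K L L :=
    aeval (Sum.elim (fun i => l (ι (X i))) (fun i => r (ι (X i))))
  have hl (p : MvPolynomial (Fin n) k) : Ψ (rename Sum.inl p) = l (ι p) := by
    have : (Ψ.comp (rename Sum.inl)) = l.comp ι := by ext i; simp [Ψ]
    exact DFunLike.congr_fun this p
  have hr (p : MvPolynomial (Fin n) k) : Ψ (rename Sum.inr p) = r (ι p) := by
    have : (Ψ.comp (rename Sum.inr)) = r.comp ι := by ext i; simp [Ψ]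
    exact DFunLike.congr_fun this p
  have hker : Ideal.span (Set.range fun i => D (f i)) ≤ RingHom.ker Ψ := by
    rw [Ideal.span_le]
    rintro _ ⟨i, rfl⟩
    rw [SetLike.mem_coe, RingHom.mem_ker, map_sub, hl, hr, sub_eq_zero]
    exact Algebra.TensorProduct.tmul_one_eq_one_tmul
      (⟨ι (f i), IntermediateField.subset_adjoin k _ ⟨i, rfl⟩⟩ : K)
  -- Since `ν ≤ χ ^ ν`, the exponent can be a power of `χ`, which commutes with the difference in
  -- `D`.
  have hpow : D g ^ χ ^ ν ∈ Ideal.span (Set.range fun i => D (f i)) :=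
    Ideal.pow_mem_of_pow_mem _ hν (Nat.lt_pow_self hprime.out.one_lt).le
  have hpow' : D g ^ χ ^ ν = D (g ^ χ ^ ν) := by
    simp only [D, map_pow]
    exact sub_pow_char_pow ..
  have key := hker hpow
  rw [hpow', RingHom.mem_ker, map_sub, hl, hr, sub_eq_zero] at key
  obtain ⟨⟨z, hz⟩, hz'⟩ := mem_range_algebraMap_of_tmul_one_eq (K := K) key
  change z = _ at hz'
  rw [IntermediateField.mem_adjoin_range_iff] at hz
  have hcomp (p : MvPolynomial (Fin m) k) : aeval (fun i => ι (f i)) p = ι (aeval f p) := by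
    rw [← comp_aeval_apply]
  obtain ⟨u, v, huv⟩ := hz
  rw [hcomp, hcomp, hz'] at huv
  -- The quotient may have the junk form `x / 0 = 0`.
  by_cases hv : v = 0
  · refine ⟨ν, 0, 1, one_ne_zero, ?_⟩
    have : g ^ χ ^ ν = 0 := hι (by simpa [hv] using huv)
    simp [this]
  · refine ⟨ν, u, v, hv, hι ?_⟩
    have hv' : ι (aeval f v) ≠ 0 := fun h0 =>
      hv (hf (by simpa using hι (h0.trans (map_zero ι).symm)))
    rw [map_mul, huv, mul_div_cancel₀ _ hv']

section HeightOne

-- Enlarge `I` to a prime `P` avoiding the nonzero constants and pick a prime element `h ∈ P`. In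
-- `F[X]`, with `F = Frac D`, nonzero primes are maximal, so `(h)` and `P` have the same extension,
-- hence the same contraction.
open Polynomial in
attribute [local instance] Polynomial.algebra Polynomial.isLocalization in
theorem _root_.Polynomial.exists_prime_le_span_singleton {D : Type*} [CommRing D] [IsDomain D]
    [UniqueFactorizationMonoid D] {I : Ideal D[X]} (hI : ∀ d, Polynomial.C d ∈ I → d = 0)
    (h0 : I ≠ ⊥) : ∃ h : D[X], Prime h ∧ I ≤ Ideal.span {h} := by
  let F := FractionRing D
  let M : Submonoid D[X] := (nonZeroDivisors D).map Polynomial.C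
  have hdisj : Disjoint (I : Set D[X]) M := by
    rw [Set.disjoint_left]
    rintro _ hI' ⟨d, hd, rfl⟩
    exact nonZeroDivisors.ne_zero hd (hI d hI')
  obtain ⟨P, hP, hIP, hPM⟩ := I.exists_le_prime_disjoint M hdisj
  have hP0 : P ≠ ⊥ := fun h => h0 (le_bot_iff.mp (h ▸ hIP))
  obtain ⟨h, hhP, hh⟩ := hP.exists_mem_prime_of_ne_bot hP0
  have hle : Ideal.span {h} ≤ P := (Ideal.span_singleton_le_iff_mem P).mpr hhP
  have hhP' : (Ideal.span {h}).IsPrime := (Ideal.span_singleton_prime hh.ne_zero).mpr hh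
  have hdisj' : Disjoint (M : Set D[X]) (Ideal.span {h} : Ideal D[X]) :=
    hPM.symm.mono_right hle
  have hJ := IsLocalization.isPrime_of_isPrime_disjoint M F[X] _ hhP' hdisj'
  have hJ' := IsLocalization.isPrime_of_isPrime_disjoint M F[X] _ hP hPM.symm
  have hJ0 : (Ideal.span {h}).map (algebraMap D[X] F[X]) ≠ ⊥ := by
    rw [Ideal.map_span, Set.image_singleton, Ne, Ideal.span_singleton_eq_bot]
    exact fun h' => hh.ne_zero
      (Polynomial.map_injective _ (IsFractionRing.injective D F) (by simpa using h'))
  have heq := (hJ.isMaximal hJ0).eq_of_le hJ'.ne_top (Ideal.map_mono hle)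
  refine ⟨h, hh, hIP.trans ?_⟩
  rw [← IsLocalization.under_map_of_isPrime_disjoint M F[X] hhP' hdisj', heq]
  exact Ideal.le_comap_map

/-- An ideal which contains no nonzero polynomial in the variables other than `X j` is zero or lies
in a prime ideal of height one. -/
theorem exists_prime_le_span_singleton {σ k : Type*} [Field k] (j : σ)
    {I : Ideal (MvPolynomial σ k)} (hI : ∀ p ∈ I, p ∈ supported k {j}ᶜ → p = 0) (h0 : I ≠ ⊥) :
    ∃ h : MvPolynomial σ k, Prime h ∧ I ≤ Ideal.span {h} := by
  classical
  let e := (renameEquiv k (Equiv.optionSubtypeNe j).symm).trans (optionEquivLeft k _)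
  have he (d : MvPolynomial {i // i ≠ j} k) :
      e.symm (Polynomial.C d) = rename Subtype.val d := by
    rw [AlgEquiv.symm_apply_eq]
    have : (Polynomial.CAlgHom : MvPolynomial {i // i ≠ j} k →ₐ[k] _) =
        e.toAlgHom.comp (rename Subtype.val) := by
      ext i : 1
      simp [e, Equiv.optionSubtypeNe_symm_of_ne i.2]
    exact DFunLike.congr_fun this d
  obtain ⟨h, hh, hle⟩ := Polynomial.exists_prime_le_span_singleton (I := I.comap e.symm)
    (fun d hd => by
      refine rename_injective _ Subtype.val_injective ((hI _ (he d ▸ hd) ?_).trans (map_zero _).symm)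
      rw [supported_eq_range_rename]
      exact ⟨d, rfl⟩)
    (fun h => h0 (by
      rw [eq_bot_iff]
      intro p hp
      have : e p ∈ I.comap e.symm := by simpa using hp
      simpa [h] using this))
  refine ⟨e.symm h, (MulEquiv.prime_iff e.symm).mpr hh, fun p hp => ?_⟩
  have : e p ∈ I.comap e.symm := by simpa using hp
  obtain ⟨c, hc⟩ := Ideal.mem_span_singleton.mp (hle this)
  exact Ideal.mem_span_singleton.mpr ⟨e.symm c, by rw [← map_mul, ← hc, e.symm_apply_apply]⟩

end HeightOne

/-! ### Chevalley's theorem and almost surjectivity -/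

theorem finitePresentation_aeval (f : Fin m → MvPolynomial (Fin n) k) :
    (aeval f : MvPolynomial (Fin m) k →ₐ[k] MvPolynomial (Fin n) k).toRingHom.FinitePresentation := by
  rw [← RingHom.FinitePresentation.of_finiteType]
  refine RingHom.FiniteType.of_comp_finiteType (f := algebraMap k (MvPolynomial (Fin m) k)) ?_
  rw [AlgHom.toRingHom_eq_coe, AlgHom.comp_algebraMap, RingHom.finiteType_algebraMap]
  infer_instance

/-- The image of a polynomial map contains a nonempty open subset of the zero locus of every prime
in the image of the associated map of spectra. -/
theorem exists_notMem_forall_mem_range [IsAlgClosed k] (f : Fin m → MvPolynomial (Fin n) k)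
    (P : PrimeSpectrum (MvPolynomial (Fin m) k))
    (hP : P ∈ Set.range (PrimeSpectrum.comap (aeval f :
      MvPolynomial (Fin m) k →ₐ[k] MvPolynomial (Fin n) k).toRingHom)) :
    ∃ u ∉ P.asIdeal, ∀ x : Fin m → k, (∀ p ∈ P.asIdeal, eval x p = 0) → eval x u ≠ 0 →
      x ∈ Set.range (polyMap f) := by
  obtain ⟨S, hS⟩ := PrimeSpectrum.exists_constructibleSetData_iff.mpr
    (PrimeSpectrum.isConstructible_range_comap (finitePresentation_aeval f))
  rw [← hS] at hP
  simp only [PrimeSpectrum.ConstructibleSetData.toSet, Set.mem_iUnion] at hP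
  obtain ⟨c, hc, hPc, hPu⟩ := hP
  refine ⟨c.f, by simpa using hPu, fun x hx hu => ?_⟩
  have hmem : pointToPoint x ∈ S.toSet := by
    simp only [PrimeSpectrum.ConstructibleSetData.toSet, Set.mem_iUnion]
    refine ⟨c, hc, fun p hp => ?_, ?_⟩
    · exact (mem_vanishingIdeal_singleton_iff x p).mpr (hx p (hPc hp))
    · intro h
      exact hu ((mem_vanishingIdeal_singleton_iff x c.f).mp (h rfl))
  rw [hS] at hmem
  obtain ⟨Q, hQ⟩ := hmem
  obtain ⟨a, ha⟩ := exists_eval_eq_zero_of_ne_top Q.2.ne_top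
  refine ⟨a, funext fun i => ?_⟩
  have h1 : (X i - C (x i) : MvPolynomial (Fin m) k) ∈ (pointToPoint x).asIdeal :=
    (mem_vanishingIdeal_singleton_iff x _).mpr (by simp)
  rw [← hQ] at h1
  simpa [sub_eq_zero, polyMap] using ha _ h1

theorem vanishingIdeal_zariskiClosure (A : Set (Fin m → k)) :
    vanishingIdeal k (zariskiClosure A) = vanishingIdeal k A :=
  zeroLocus_vanishingIdeal_galoisConnection.u_l_u_eq_u A

/-- A map is almost surjective if and only if, for every `j`, a nonzero polynomial which does not
involve the variable `X j` vanishes outside its range. -/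
theorem almostSurjective_iff (hm : 1 ≤ m) (f : Fin m → MvPolynomial (Fin n) k) :
    AlmostSurjective f ↔ ∀ j : Fin m, ∃ p ∈ vanishingIdeal k (Set.range (polyMap f))ᶜ,
      p ∈ supported k {j}ᶜ ∧ p ≠ 0 := by
  classical
  rw [AlmostSurjective, algDim, vanishingIdeal_zariskiClosure]
  set I := vanishingIdeal k (Set.range (polyMap f))ᶜ with hI
  split_ifs with hC
  · have hC' : (Set.range (polyMap f))ᶜ = ∅ :=
      Set.subset_eq_empty (zeroLocus_vanishingIdeal_le _) hC
    refine iff_of_true (by lia) fun j => ⟨1, ?_, one_mem _, one_ne_zero⟩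
    rw [hI, hC', vanishingIdeal_empty]
    trivial
  · set T := (Finset.univ : Finset (Finset (Fin m))).filter fun S : Finset (Fin m) =>
      ∀ p ∈ I, p ∈ supported k (S : Set (Fin m)) → p = 0 with hT
    have hT0 : ∅ ∈ T := by
      refine Finset.mem_filter.mpr ⟨Finset.mem_univ _, fun p hp hps => ?_⟩
      rw [Finset.coe_empty, supported_empty, Algebra.mem_bot] at hps
      obtain ⟨c, rfl⟩ := hps
      by_contra hc
      have hc' : c ≠ 0 := fun h => hc (by simp [h])
      apply hC
      rw [zariskiClosure, Set.eq_empty_iff_forall_notMem]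
      intro x hx
      exact hc' (by simpa using hx _ hp)
    constructor
    · intro h j
      by_contra! hj
      have hmem : ({j}ᶜ : Finset (Fin m)) ∈ T :=
        Finset.mem_filter.mpr ⟨Finset.mem_univ _, fun p hp hps => hj p hp (by simpa using hps)⟩
      have := Finset.le_sup (f := Finset.card) hmem
      rw [Finset.card_compl, Finset.card_singleton, Fintype.card_fin] at this
      lia
    · intro h
      obtain ⟨S, hS, hS'⟩ := Finset.exists_mem_eq_sup T ⟨_, hT0⟩ Finset.card
      rw [hS']
      by_contra! hlt
      -- Exceeding `m - 2` means omitting at most one index, so `S` contains some `{j}ᶜ`.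
      have hcard : Sᶜ.card ≤ 1 := by
        rw [Finset.card_compl, Fintype.card_fin]
        lia
      have : Nonempty (Fin m) := ⟨⟨0, hm⟩⟩
      obtain ⟨j, hj⟩ := Finset.card_le_one_iff_subset_singleton.mp hcard
      obtain ⟨p, hp, hps, hp0⟩ := h j
      refine hp0 ((Finset.mem_filter.mp hS).2 p hp (supported_mono (fun i hi => ?_) hps))
      by_contra hiS
      exact hi (Finset.mem_singleton.mp (hj (Finset.mem_compl.mpr hiS)))

/-! ### The two implications -/

/-- If `f` is almost surjective, then every polynomial determined by `f` has some `χ ^ ν`-th power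
in `k[f]`. -/
theorem AlmostSurjective.determined_subset_radChar [IsAlgClosed k] {χ : ℕ} [CharP k χ] (hχ : 0 < χ)
    (hm : 1 ≤ m) {f : Fin m → MvPolynomial (Fin n) k} (hf : AlgebraicIndependent k f)
    (h : AlmostSurjective f) : (determined f : Set (MvPolynomial (Fin n) k)) ⊆
      radChar χ (Algebra.adjoin k (Set.range f) : Set (MvPolynomial (Fin n) k)) := by
  intro g hg
  rw [almostSurjective_iff hm] at h
  obtain ⟨ν, u', v', hv', huv'⟩ := exists_pow_mul_aeval_eq_aeval hχ hf hg
  obtain ⟨v, u, c, hrel, rfl, rfl⟩ := UniqueFactorizationMonoid.exists_reduced_factors v' hv' u'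
  have hc : aeval f c ≠ 0 := fun h0 => left_ne_zero_of_mul hv' (hf (by simpa using h0))
  have hv : v ≠ 0 := right_ne_zero_of_mul hv'
  rw [map_mul, map_mul, mul_assoc] at huv'
  have huv := mul_left_cancel₀ hc huv'
  refine ⟨ν, ?_⟩
  rw [SetLike.mem_coe, Algebra.adjoin_range_eq_range_aeval]
  by_cases hunit : IsUnit v
  · obtain ⟨w, hw⟩ := hunit.exists_left_inv
    refine ⟨w * u, ?_⟩
    change aeval f (w * u) = _
    rw [map_mul, ← huv, ← mul_assoc, ← map_mul, hw, map_one, one_mul]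
  obtain ⟨q, hq, hqv⟩ := WfDvdMonoid.exists_irreducible_factor hunit hv
  have hqp := hq.prime
  have hvars : q.vars.Nonempty := by
    rw [Finset.nonempty_iff_ne_empty]
    intro h0
    have hqC := vars_eq_empty_iff_eq_C.mp h0
    refine hqp.not_isUnit (hqC ▸ (isUnit_iff_ne_zero.mpr fun hr => hqp.ne_zero ?_).map C)
    rw [hqC, hr, C_0]
  obtain ⟨j, hj⟩ := hvars
  obtain ⟨p, hp, hps, hp0⟩ := h j
  have hdvd : q ∣ u * p := by
    refine dvd_of_forall_eval hqp fun x hx => ?_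
    rw [map_mul]
    by_cases hxr : x ∈ Set.range (polyMap f)
    · obtain ⟨a, rfl⟩ := hxr
      have hva : eval (polyMap f a) v = 0 := zero_dvd_iff.mp (hx ▸ map_dvd (eval (polyMap f a)) hqv)
      have := congrArg (eval a) huv
      rw [map_mul, eval_aeval, eval_aeval, hva, zero_mul] at this
      rw [← this, zero_mul]
    · rw [← aeval_eq_eval x, hp x hxr, mul_zero]
  rcases hqp.dvd_or_dvd hdvd with h1 | ⟨r, rfl⟩
  · exact absurd (hrel hqv h1) hqp.not_isUnit
  · rw [mem_supported] at hps
    refine absurd (hps (mem_vars_iff_degreeOf_ne_zero.mpr ?_)) (by simp : j ∉ ({j}ᶜ : Set (Fin m)))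
    rw [degreeOf_mul_eq hqp.ne_zero (right_ne_zero_of_mul hp0)]
    have := mem_vars_iff_degreeOf_ne_zero.mp hj
    lia

/-- If `f` is not almost surjective, there are a prime polynomial `h` and a polynomial `u` not
divisible by `h` such that `h(f)` divides `u(f)`. -/
theorem exists_prime_aeval_dvd_of_not_almostSurjective [IsAlgClosed k] (hm : 1 ≤ m)
    {f : Fin m → MvPolynomial (Fin n) k} (hf : AlgebraicIndependent k f)
    (hA : ¬ AlmostSurjective f) :
    ∃ h u : MvPolynomial (Fin m) k, Prime h ∧ ¬ h ∣ u ∧ aeval f h ∣ aeval f u := by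
  rw [almostSurjective_iff hm] at hA
  push Not at hA
  obtain ⟨j, hj⟩ := hA
  set I := vanishingIdeal k (Set.range (polyMap f))ᶜ with hI
  -- Algebraic independence puts the generic point in the image on spectra, so the range contains a
  -- nonempty open set.
  have hI0 : I ≠ ⊥ := by
    intro h0
    obtain ⟨u, hu, hur⟩ := exists_notMem_forall_mem_range f ⊥ ⟨⊥, by
      ext p
      simpa using map_eq_zero_iff _ hf⟩
    apply hu
    suffices u ∈ I by simpa [h0] using this
    intro x hx
    by_contra hne
    exact hx (hur x (by simp) hne)
  obtain ⟨h, hh, hle⟩ := exists_prime_le_span_singleton j hj hI0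
  have hprime : (Ideal.span {h}).IsPrime := (Ideal.span_singleton_prime hh.ne_zero).mpr hh
  have hrange : (⟨Ideal.span {h}, hprime⟩ : PrimeSpectrum (MvPolynomial (Fin m) k)) ∉
      Set.range (PrimeSpectrum.comap (aeval f :
        MvPolynomial (Fin m) k →ₐ[k] MvPolynomial (Fin n) k).toRingHom) := by
    intro hmem
    obtain ⟨u, hu, hur⟩ := exists_notMem_forall_mem_range f _ hmem
    -- Write `d = h ^ e * w` with `h ∤ w`. Off the range either `w` vanishes, or `h` does and then
    -- so does `u`; thus `u * w ∈ I ≤ (h)`.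
    obtain ⟨d, hd, hd0⟩ := Submodule.exists_mem_ne_zero_of_ne_bot hI0
    obtain ⟨w, hdw, hw⟩ :=
      (FiniteMultiplicity.of_prime_left hh hd0).exists_eq_pow_mul_and_not_dvd
    have huw : u * w ∈ I := by
      intro x hx
      have hdx := hd x hx
      rw [hdw, map_mul, map_pow, mul_eq_zero] at hdx
      rw [map_mul, mul_eq_zero]
      refine hdx.imp_left fun hhx => ?_
      by_contra hne
      refine hx (hur x (fun p hp => ?_) hne)
      have hhx' : eval x h = 0 := eq_zero_of_pow_eq_zero hhx
      exact zero_dvd_iff.mp (hhx' ▸ map_dvd (eval x) (Ideal.mem_span_singleton.mp hp))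
    rcases hprime.mem_or_mem (hle huw) with h1 | h1
    · exact hu h1
    · exact hw (Ideal.mem_span_singleton.mp h1)
  rw [PrimeSpectrum.mem_range_comap_iff] at hrange
  have hlt := lt_of_le_of_ne Ideal.le_comap_map (Ne.symm hrange)
  obtain ⟨u, hu, hu'⟩ := SetLike.exists_of_lt hlt
  refine ⟨h, u, hh, fun hd => hu' (Ideal.mem_span_singleton.mpr hd), ?_⟩
  rw [Ideal.mem_comap, Ideal.map_span, Set.image_singleton] at hu
  exact Ideal.mem_span_singleton.mp hu

/-- The quotient `g = u(f) / h(f)` is determined only where `h(f) ≠ 0`; the extra factor `u(f)`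
kills it elsewhere. A `χ^ν`-th power in `k[f]` would force `h ∣ u`. -/
theorem exists_mem_determined_notMem_radChar [IsAlgClosed k] {χ : ℕ} (hχ : 0 < χ) (hm : 1 ≤ m)
    {f : Fin m → MvPolynomial (Fin n) k} (hf : AlgebraicIndependent k f)
    (hA : ¬ AlmostSurjective f) : ∃ g ∈ determined f,
      g ∉ radChar χ (Algebra.adjoin k (Set.range f) : Set (MvPolynomial (Fin n) k)) := by
  obtain ⟨h, u, hh, hu, g, hg⟩ := exists_prime_aeval_dvd_of_not_almostSurjective hm hf hA
  refine ⟨aeval f u * g, ?_, ?_⟩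
  · intro a b hab
    have hab' : polyMap f a = polyMap f b := funext hab
    have ha := congrArg (eval a) hg
    have hb := congrArg (eval b) hg
    simp only [map_mul, eval_aeval, hab'] at ha hb ⊢
    by_cases h0 : eval (polyMap f b) h = 0
    · rw [ha, h0, zero_mul, zero_mul, zero_mul]
    · rw [mul_left_cancel₀ h0 (ha.symm.trans hb)]
  · rintro ⟨ν, hν⟩
    rw [SetLike.mem_coe, Algebra.adjoin_range_eq_range_aeval] at hν
    obtain ⟨p, hp⟩ := hν
    change aeval f p = _ at hp
    have hpow : h ^ χ ^ ν * p = (u * u) ^ χ ^ ν := by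
      apply hf
      rw [map_mul, hp, map_pow, map_pow, map_mul, ← mul_pow, mul_left_comm, ← hg]
    have hdvd : h ∣ (u * u) ^ χ ^ ν := hpow ▸ (dvd_pow_self h (pow_pos hχ ν).ne').mul_right p
    exact (hh.dvd_or_dvd (hh.dvd_of_dvd_pow hdvd)).elim hu hu

end FDetermined

theorem mainTheorem5 {k : Type*} [Field k] [IsAlgClosed k] (χ : ℕ) [CharP k χ] (hχ : 0 < χ)
    (m n : ℕ) (hm : 1 ≤ m) (hn : 1 ≤ n) (f : Fin m → MvPolynomial (Fin n) k)
    (hf : AlgebraicIndependent k f) :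
    (FDetermined.determined f : Set (MvPolynomial (Fin n) k)) =
        FDetermined.radChar χ (Algebra.adjoin k (Set.range f) : Set (MvPolynomial (Fin n) k)) ↔
      FDetermined.AlmostSurjective f := by
  constructor
  · intro h
    by_contra hA
    obtain ⟨g, hg, hg'⟩ := FDetermined.exists_mem_determined_notMem_radChar hχ hm hf hA
    exact hg' (h ▸ hg)
  · intro h
    exact (h.determined_subset_radChar hχ hm hf).antisymm
      (FDetermined.radChar_subset_determined hχ f)
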